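/- Let $\mathcal A$ be a unital $C^*$-algebra and let $H_{\mathcal A}$ be the standard Hilbert module over $\mathcal A$, i.e. the (left) $\mathcal A$-module of all sequences $x=(x_i)_{i\ge 0}$ in $\mathcal A$ for which $\sum_i x_i x_i^*$ converges in norm, with inner product $\langle x,y\rangle=\sum_i y_i x_i^*$ and norm $\|x\|=\|\langle x,x\rangle\|^{1/2}$. A submodule is called finitely generated if it is the linear span over $\mathcal A$ of a finite subset, and $\tilde\oplus$ denotes a direct sum of closed submodules that need not be orthogonal. For a bounded $\mathcal A$-linear operator $F:H_{\mathcal A}\to H_{\mathcal A}$, say that a pair of decompositions $$H_{\mathcal A}=M_1\tilde\oplus N_1\ \xrightarrow{\;F\;}\ M_2\tilde\oplus N_2=H_{\mathcal A}$$ into closed submodules diagonalizes $F$ if $F(M_1)\subseteq M_2$, $F(N_1)\subseteq N_2$ and $F|_{M_1}:M_1\to M_2$ is an isomorphism, i.e. an $\mathcal A$-linear bijection that is bounded together with its inverse; in other words, $F$ has the matrix $\begin{bmatrix}F_1&0\\0&F_4\end{bmatrix}$ with $F_1$ an isomorphism. The operator $F$ is $\mathcal A$-Fredholm if it is adjointable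 and is diagonalized by some such pair in which $N_1$ and $N_2$ are finitely generated. **Lemma.** Let $F$ be an $\mathcal A$-Fredholm operator on $H_{\mathcal A}$, and let $$H_{\mathcal A}=M_1\tilde\oplus N_1\ \xrightarrow{\;F\;}\ M_2\tilde\oplus N_2=H_{\mathcal A},\qquad H_{\mathcal A}=M_1'\tilde\oplus N_1'\ \xrightarrow{\;F\;}\ M_2'\tilde\oplus N_2'=H_{\mathcal A}$$ be two pairs of decompositions into closed submodules that diagonalize $F$. Suppose that $N_1$, $N_1'$ and $N_2$ are finitely generated (while $N_2'$ is only assumed to be closed). Then $N_2'$ is finitely generated. -/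

import Mathlib

/-! ### The standard Hilbert module `H_A`

Hilbert modules are used in Mathlib's convention (`CStarModule`): left modules, with an `A`-valued
inner product that is linear in the second variable. -/

section StandardModule

variable {A : Type*} [CStarAlgebra A] [PartialOrder A] [StarOrderedRing A]

theorem summable_of_nonneg_of_le_cstar {f g : ℕ → A} (hf : ∀ i, 0 ≤ f i) (hfg : ∀ i, f i ≤ g i)
    (hg : Summable g) : Summable f := by
  rw [summable_iff_vanishing_norm] at hg ⊢
  intro ε hε
  obtain ⟨s, hs⟩ := hg ε hε
  refine ⟨s, fun t ht => lt_of_le_of_lt ?_ (hs t ht)⟩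
  exact CStarAlgebra.norm_le_norm_of_nonneg_of_le (Finset.sum_nonneg fun i _ => hf i)
    (Finset.sum_le_sum fun i _ => hfg i)

theorem add_mul_star_add_le (a b : A) :
    (a + b) * star (a + b) ≤ (2 : ℕ) • (a * star a) + (2 : ℕ) • (b * star b) := by
  have h : 0 ≤ (a - b) * star (a - b) := mul_star_self_nonneg _
  have h2 : (2 : ℕ) • (a * star a) + (2 : ℕ) • (b * star b)
      = (a + b) * star (a + b) + (a - b) * star (a - b) := by
    simp only [star_add, star_sub]
    noncomm_ring
  rw [h2]
  exact le_add_of_nonneg_right h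

variable (A) in
/-- The `A`-module of all sequences `(x₀, x₁, …)` in `A` for which `∑ xᵢ xᵢ*` converges in norm
(for a series of positive elements of a C⋆-algebra, norm convergence of the partial sums
is the same as `Summable`). -/
def stdSeq : Submodule A (ℕ → A) where
  carrier := {x | Summable fun i => x i * star (x i)}
  zero_mem' := by simp [summable_zero]
  add_mem' {x y} hx hy :=
    summable_of_nonneg_of_le_cstar (fun i => mul_star_self_nonneg _)
      (fun i => add_mul_star_add_le (x i) (y i))
      ((hx.const_smul (2 : ℕ)).add (hy.const_smul (2 : ℕ)))
  smul_mem' a x hx := by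
    have h := (hx.mul_left a).mul_right (star a)
    have e : (fun i => (a • x) i * star ((a • x) i))
        = fun i => a * (x i * star (x i)) * star a := by
      funext i
      simp [mul_assoc]
    change Summable fun i => (a • x) i * star ((a • x) i)
    rw [e]
    simpa only [mul_assoc] using h

variable (A) in
/-- The standard Hilbert module `H_A = ℓ²(A)` over the C⋆-algebra `A`. -/
def StdModule : Type _ := stdSeq A

namespace StdModule

instance : AddCommGroup (StdModule A) := inferInstanceAs (AddCommGroup (stdSeq A))
instance : Module A (StdModule A) := inferInstanceAs (Module A (stdSeq A))
noncomputable instance : Module ℂ (StdModule A) := inferInstanceAs (Module ℂ (stdSeq A))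
instance : IsScalarTower ℂ A (StdModule A) := inferInstanceAs (IsScalarTower ℂ A (stdSeq A))

/-- The entries of an element of `H_A`. -/
instance : CoeFun (StdModule A) fun _ => ℕ → A := ⟨fun x => x.1⟩

@[ext] theorem ext {x y : StdModule A} (h : ∀ i, x i = y i) : x = y := Subtype.ext (funext h)

@[simp] theorem add_apply (x y : StdModule A) (i : ℕ) : (x + y) i = x i + y i := rfl
@[simp] theorem zero_apply (i : ℕ) : (0 : StdModule A) i = 0 := rfl
@[simp] theorem smul_apply (a : A) (x : StdModule A) (i : ℕ) : (a • x) i = a * x i := rfl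
@[simp] theorem complex_smul_apply (z : ℂ) (x : StdModule A) (i : ℕ) : (z • x) i = z • x i := rfl

theorem summable_self (x : StdModule A) : Summable fun i => x i * star (x i) := x.2

theorem summable_inner (x y : StdModule A) : Summable fun i => y i * star (x i) := by
  have h := (((summable_self (y + x)).add
    ((summable_self (y + Complex.I • x)).const_smul Complex.I)).add
    ((summable_self (y + (-1 : ℂ) • x)).const_smul (-1 : ℂ))).add
    ((summable_self (y + (-Complex.I) • x)).const_smul (-Complex.I))
  have h4 := h.const_smul (4⁻¹ : ℂ)
  refine h4.congr fun i => ?_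
  simp only [add_apply, complex_smul_apply, star_add, star_smul, RCLike.star_def,
    Complex.conj_I, map_neg, map_one, mul_add, add_mul, smul_mul_assoc, mul_smul_comm, smul_add,
    smul_smul]
  match_scalars <;> ring_nf <;> simp [Complex.I_sq]; norm_num

/-- The inner product `⟪x, y⟫ = ∑ yᵢ xᵢ*`. -/
noncomputable instance : Inner A (StdModule A) := ⟨fun x y => ∑' i, y i * star (x i)⟩

theorem inner_def (x y : StdModule A) : inner A x y = ∑' i, y i * star (x i) := rfl

/-- The norm `‖x‖ = ‖⟪x, x⟫‖^(1/2)`. -/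
noncomputable instance : Norm (StdModule A) := ⟨fun x => √‖(inner A x x : A)‖⟩

noncomputable instance : CStarModule A (StdModule A) where
  inner_add_right {x y z} := by
    simp only [inner_def, add_apply, add_mul]
    exact (summable_inner x y).tsum_add (summable_inner x z)
  inner_self_nonneg := tsum_nonneg fun _ => mul_star_self_nonneg _
  inner_self {x} := by
    refine ⟨fun h => ?_, fun h => by simp [h, inner_def]⟩
    have h0 := ((summable_self x).hasSum_iff.2 h)
    rw [hasSum_zero_iff_of_nonneg fun _ => mul_star_self_nonneg _] at h0
    ext i
    exact (CStarRing.mul_star_self_eq_zero_iff _).1 (congrFun h0 i)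
  inner_op_smul_right {a x y} := by
    simp only [inner_def, smul_apply, mul_assoc]
    exact (summable_inner x y).tsum_mul_left a
  inner_smul_right_complex {z x y} := by
    simp only [inner_def, complex_smul_apply, smul_mul_assoc]
    exact (summable_inner x y).tsum_const_smul z
  star_inner x y := by
    simp only [inner_def, tsum_star, star_mul, star_star]
  norm_eq_sqrt_norm_inner_self _ := rfl

noncomputable instance : NormedAddCommGroup (StdModule A) := CStarModule.normedAddCommGroup A

noncomputable instance : NormedSpace ℂ (StdModule A) :=
  NormedSpace.ofCore (CStarModule.normedSpaceCore A)

end StdModule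

/-! ### Fredholm operators on `H_A` -/

/-- The bounded `A`-linear operator `F` on `H_A` is adjointable. -/
def IsAdjointable (F : StdModule A →L[A] StdModule A) : Prop :=
  ∃ G : StdModule A →L[A] StdModule A, ∀ x y, (inner A (F x) y : A) = inner A x (G y)

/-- `H_A = M₁ ⊕̃ N₁ → M₂ ⊕̃ N₂ = H_A` is a pair of decompositions into (not necessarily orthogonal)
topological direct sums of closed submodules, with respect to which `F` has a diagonal matrix
`diag(F₁, F₄)` where `F₁ : M₁ → M₂` is an isomorphism, that is, an `A`-linear bijection which is
bounded together with its inverse. -/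
structure IsDiagonalizing (F : StdModule A →L[A] StdModule A)
    (M₁ N₁ M₂ N₂ : Submodule A (StdModule A)) : Prop where
  isClosed_M₁ : IsClosed (M₁ : Set (StdModule A))
  isClosed_N₁ : IsClosed (N₁ : Set (StdModule A))
  isClosed_M₂ : IsClosed (M₂ : Set (StdModule A))
  isClosed_N₂ : IsClosed (N₂ : Set (StdModule A))
  domain_isCompl : IsCompl M₁ N₁
  codomain_isCompl : IsCompl M₂ N₂
  mapsTo_N : ∀ x ∈ N₁, F x ∈ N₂
  iso : ∃ F₁ : M₁ ≃L[A] M₂, ∀ x : M₁, (F₁ x : StdModule A) = F x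

/-- `F` is `A`-Fredholm: it is adjointable and it is diagonalized by a pair of decompositions in
which both `N₁` and `N₂` are finitely generated. As `A` is unital, the span of a set over `ℂ` and
`A` is its `A`-span, so this is `Submodule.FG`. -/
def IsAFredholm (F : StdModule A →L[A] StdModule A) : Prop :=
  IsAdjointable F ∧ ∃ M₁ N₁ M₂ N₂ : Submodule A (StdModule A),
    IsDiagonalizing F M₁ N₁ M₂ N₂ ∧ N₁.FG ∧ N₂.FG

end StandardModule

/-! The range of `F` contains `M₂` and `N₂` is finitely generated, so the cokernel of `F` is
finitely generated. This range is also `M₂' + F(N₁')`, so `N₂' ≅ H_A / M₂'` is an extension of the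
cokernel by a quotient of the finitely generated module `N₁'`. -/

section FinitelyGeneratedCokernel

variable {R E E' : Type*} [Ring R] [AddCommGroup E] [Module R E] [AddCommGroup E'] [Module R E']

theorem cofg_of_cofg_sup_of_fg {P Q : Submodule R E} (hPQ : (P ⊔ Q).CoFG) (hQ : Q.FG) :
    P.CoFG := by
  have : Module.Finite R (Q.map P.mkQ) := Module.Finite.iff_fg.2 (hQ.map P.mkQ)
  have : Module.Finite R ((E ⧸ P) ⧸ Q.map P.mkQ) :=
    .equiv (Submodule.quotientQuotientEquivQuotientSup P Q).symm
  exact .of_submodule_quotient (Q.map P.mkQ)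

theorem cofg_map_of_codisjoint {f : E →ₗ[R] E'} {M N : Submodule R E} (hf : f.range.CoFG)
    (hMN : Codisjoint M N) (hN : N.FG) : (M.map f).CoFG := by
  have hrange : f.range = M.map f ⊔ N.map f := by
    rw [LinearMap.range_eq_map, ← hMN.eq_top, Submodule.map_sup]
  exact cofg_of_cofg_sup_of_fg (hrange ▸ hf) (hN.map f)

theorem lemma2p16_general {f : E →ₗ[R] E'} {M₁ N₁ : Submodule R E} {M₂ N₂ : Submodule R E'}
    (hf : f.range.CoFG) (h₁ : Codisjoint M₁ N₁) (h₂ : IsCompl M₂ N₂) (hM : M₁.map f ≤ M₂)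
    (hN₁ : N₁.FG) : N₂.FG :=
  (Submodule.CoFG.of_le hM (cofg_map_of_codisjoint hf h₁ hN₁)).fg_of_isCompl h₂

end FinitelyGeneratedCokernel

namespace IsDiagonalizing

variable {A : Type*} [CStarAlgebra A] [PartialOrder A] [StarOrderedRing A]
  {F : StdModule A →L[A] StdModule A} {M₁ N₁ M₂ N₂ : Submodule A (StdModule A)}

theorem map_eq (h : IsDiagonalizing F M₁ N₁ M₂ N₂) : M₁.map F.toLinearMap = M₂ := by
  obtain ⟨F₁, hF₁⟩ := h.iso
  ext y
  constructor
  · rintro ⟨x, hx, rfl⟩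
    exact hF₁ ⟨x, hx⟩ ▸ (F₁ ⟨x, hx⟩).2
  · intro hy
    exact ⟨F₁.symm ⟨y, hy⟩, (F₁.symm ⟨y, hy⟩).2, by simp [← hF₁]⟩

theorem cofg_range (h : IsDiagonalizing F M₁ N₁ M₂ N₂) (hN₂ : N₂.FG) :
    F.toLinearMap.range.CoFG :=
  (hN₂.cofg_of_codisjoint h.codomain_isCompl.symm.codisjoint).of_le
    (h.map_eq.ge.trans LinearMap.map_le_range)

end IsDiagonalizing

theorem lemma2p16 {A : Type*} [CStarAlgebra A] [PartialOrder A] [StarOrderedRing A]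
    (F : StdModule A →L[A] StdModule A) (hF : IsAFredholm F)
    (M₁ N₁ M₂ N₂ M₁' N₁' M₂' N₂' : Submodule A (StdModule A))
    (h : IsDiagonalizing F M₁ N₁ M₂ N₂)
    (h' : IsDiagonalizing F M₁' N₁' M₂' N₂')
    (hN₁ : N₁.FG) (hN₁' : N₁'.FG) (hN₂ : N₂.FG) :
    N₂'.FG :=
  lemma2p16_general (h.cofg_range hN₂) h'.domain_isCompl.codisjoint h'.codomain_isCompl
    h'.map_eq.le hN₁'
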